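/- Let $B\in\mathbb R^{n\times d}$ be a matrix of rank $d$ each of whose columns sums to $0$, let $c\in\mathbb R^n$ be a vector whose coordinates sum to $1$, and let $\mathcal M=\{c-Bx : x\in\Theta\}$ with $\Theta=\{x\in\mathbb R^d : c-Bx\ge 0\}$ be the corresponding $d$-dimensional linear model in the probability simplex $\Delta_{n-1}$. Let $p\in\mathcal M$ be an interior point, i.e. $p_i>0$ for all $i$. The logarithmic Voronoi cell of $\mathcal M$ at $p$ is $$\log\mathrm{Vor}_{\mathcal M}(p)=\Big\{u\in\Delta_{n-1} : p \text{ maximizes } \ell_u(q)=\sum_{i=1}^n u_i\log q_i \text{ over } q\in\mathcal M\Big\}$$ (with $\log 0=-\infty$ and $0\cdot(-\infty)=0$). The matrix $B$ is called a Gale diagram of points $v_1,\dots,v_n\in\mathbb R^{n-d-1}$ if its columns form a basis of the space of affine dependences $\{w\in\mathbb R^n:\sum_i w_i=0,\ \sum_i w_iv_i=0\}$. For a set $P\subseteq\mathbb R^m$ let $P^\Delta=\{z\in\mathbb R^m:\langle z,y\rangle\le 1\text{ for all }y\in P\}$ be its polar dual. Two polytopes are combinatorially equivalent if their face lattices are isomorphic.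 Then $\log\mathrm{Vor}_{\mathcal M}(p)$ is a polytope, and there is a configuration $v_1,\dots,v_n\in\mathbb R^{n-d-1}$ with Gale diagram $B$. Moreover, for every such configuration the polytope $P=\operatorname{conv}\{v_1,\dots,v_n\}$ has non-empty interior, and for every point $o$ in the interior of $P$ (so that $0$ is an interior point of the translate $P-o=\operatorname{conv}\{v_1-o,\dots,v_n-o\}$), the polar dual $(P-o)^\Delta$ is a polytope and $\log\mathrm{Vor}_{\mathcal M}(p)$ is combinatorially equivalent to it. In particular, if $0$ is an interior point of $P$, then $\log\mathrm{Vor}_{\mathcal M}(p)$ is combinatorially equivalent to $P^\Delta$. -/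

import Mathlib

open scoped Matrix

noncomputable section

/-- The linear model `{c - B x : x ∈ Θ}`, where `Θ = {x : c - B x ≥ 0}`. When the coordinates of `c`
sum to `1` and every column of `B` sums to `0`, this is the intersection of the affine space
`c + im B` with the probability simplex. -/
def linearModel {n d : ℕ} (c : Fin n → ℝ) (B : Matrix (Fin n) (Fin d) ℝ) : Set (Fin n → ℝ) :=
  {q | ∃ x : Fin d → ℝ, q = c - B *ᵥ x ∧ ∀ i, 0 ≤ q i}

/-- The log-likelihood `∑ i, u i * log (x i)` of the data point `u`, for `u` and `x` with nonnegative
coordinates. Its values are extended reals, with `log 0 = -∞` and `0 * (-∞) = 0`, so that it also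
makes sense at points `x` on the boundary of the simplex. -/
def logLikelihood {n : ℕ} (u x : Fin n → ℝ) : EReal :=
  ∑ i, (u i : EReal) * ENNReal.log (ENNReal.ofReal (x i))

/-- The logarithmic Voronoi cell at `p`: all points `u` of the probability simplex such that `p` is a
maximizer of the log-likelihood function of `u` over the model `M`. -/
def logVoronoiCell {n : ℕ} (M : Set (Fin n → ℝ)) (p : Fin n → ℝ) : Set (Fin n → ℝ) :=
  {u | u ∈ stdSimplex ℝ (Fin n) ∧ p ∈ M ∧ IsMaxOn (logLikelihood u) M p}

/-- `B` is a Gale transform (Gale diagram) of the configuration `v 1, …, v n`: the columns of `B` form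
a basis of the space of affine dependences
`{w : ∑ i, w i = 0 and ∑ i, w i • v i = 0}` of the configuration. -/
def IsGaleTransform {n d m : ℕ} (B : Matrix (Fin n) (Fin d) ℝ) (v : Fin n → Fin m → ℝ) : Prop :=
  LinearIndependent ℝ B.col ∧
    ∀ w : Fin n → ℝ, w ∈ Submodule.span ℝ (Set.range B.col) ↔
      ∑ i, w i = 0 ∧ ∑ i, w i • v i = 0

/-- A polytope is the convex hull of finitely many points. -/
def IsPolytope {k : ℕ} (P : Set (Fin k → ℝ)) : Prop :=
  ∃ s : Set (Fin k → ℝ), s.Finite ∧ P = convexHull ℝ s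

/-- The polar dual `{z : ⟨z, y⟩ ≤ 1 for all y ∈ P}`. -/
def polarDual {k : ℕ} (P : Set (Fin k → ℝ)) : Set (Fin k → ℝ) :=
  {z | ∀ y ∈ P, z ⬝ᵥ y ≤ 1}

/-- The faces of `P`: the subsets of `P` on which some linear functional attains its maximum over `P`
(in particular `P` itself), and the empty set. They are ordered by inclusion. -/
abbrev FaceLattice {k : ℕ} (P : Set (Fin k → ℝ)) : Type :=
  {F : Set (Fin k → ℝ) // IsExposed ℝ P F}

/-- Combinatorial equivalence: the face lattices are isomorphic. -/
def CombEquiv {k l : ℕ} (P : Set (Fin k → ℝ)) (Q : Set (Fin l → ℝ)) : Prop :=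
  Nonempty (FaceLattice P ≃o FaceLattice Q)

end

/-!
# Logarithmic Voronoi cells of linear models are polar duals

The log-likelihood function is concave, so `p` maximizes it over the model if and only if it is a
critical point. Hence the cell at `p` consists of the points `u` of the simplex for which
`y i = u i / p i` is orthogonal to the columns of `B` (`mem_logVoronoiCell_iff`).

If `B` is a Gale transform of `v`, the vectors orthogonal to its columns are exactly the vectors
`y i = f (v i)` of values of affine functions `f`, and `f` is determined by `y`
(`IsGaleTransform.exists_affineValues_eq`, `IsGaleTransform.ker_affineValues`). So the cell is the
slice of the cone of affine functions that are nonnegative on `P = conv {v i}` by the normalization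
`∑ i, p i * f (v i) = 1`. The polar dual of `P - o` is the slice of the same cone by the
normalization `f o = 1`: write `f x = 1 - ⟨z, x - o⟩`. Both normalizing functionals are positive on
the nonzero elements of the cone, the second one because `o` is interior
(`pos_or_zero_of_mem_interior`). Rescaling is therefore a projective bijection between the two
slices (`combEquiv_logVoronoiCell_polarDual`), and projective bijections preserve exposed faces
(`IsExposed.image_projective`).

Both slices are bounded polyhedra, hence polytopes (`isPolytope_of_isBounded`).
-/

/-! ### Bounded polyhedra are polytopes -/

/-- A point of a polyhedron is a vertex only if the inequalities tight at it single it out among the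
points of the polyhedron, so there are finitely many vertices; a bounded polyhedron is the convex
hull of its vertices by the Krein–Milman theorem. -/
theorem isPolytope_of_isBounded {k : ℕ} {ι κ : Type*} [Finite ι]
    (A : κ → (Fin k → ℝ) →ₗ[ℝ] ℝ) (e : κ → ℝ) (l : ι → (Fin k → ℝ) →ₗ[ℝ] ℝ) (b : ι → ℝ)
    (hbd : Bornology.IsBounded {x | (∀ j, A j x = e j) ∧ ∀ i, l i x ≤ b i}) :
    IsPolytope {x | (∀ j, A j x = e j) ∧ ∀ i, l i x ≤ b i} := by
  have hAc : ∀ j, Continuous (A j) := fun j => (A j).continuous_of_finiteDimensional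
  have hlc : ∀ i, Continuous (l i) := fun i => (l i).continuous_of_finiteDimensional
  set S := {x | (∀ j, A j x = e j) ∧ ∀ i, l i x ≤ b i} with hS
  have hclosed : IsClosed S := by
    have : S = (⋂ j, {x | A j x = e j}) ∩ ⋂ i, {x | l i x ≤ b i} := by
      ext x; simp [hS]
    rw [this]
    exact (isClosed_iInter fun j => isClosed_eq (hAc j) continuous_const).inter
      (isClosed_iInter fun i => isClosed_le (hlc i) continuous_const)
  have hconv : Convex ℝ S := by
    intro x hx y hy s t hs ht hst
    refine ⟨fun j => ?_, fun i => ?_⟩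
    · simp only [map_add, map_smul, smul_eq_mul, hx.1 j, hy.1 j]
      rw [← add_mul, hst, one_mul]
    · simp only [map_add, map_smul, smul_eq_mul]
      have h1 := mul_le_mul_of_nonneg_left (hx.2 i) hs
      have h2 := mul_le_mul_of_nonneg_left (hy.2 i) ht
      calc _ ≤ s * b i + t * b i := add_le_add h1 h2
        _ = b i := by rw [← add_mul, hst, one_mul]
  have hcomp : IsCompact S := Metric.isCompact_of_isClosed_isBounded hclosed hbd
  have hfin : (S.extremePoints ℝ).Finite := by
    refine Set.Finite.of_finite_image (f := fun x => {i | l i x = b i}) (Set.toFinite _) ?_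
    intro x hx y hy hxy
    have hxy' : ∀ i, l i x = b i → l i y = b i := fun i hi =>
      (Set.ext_iff.1 hxy i).1 hi
    -- the line through `x` and `y` stays in the polyhedron for a while on both sides of `x`
    have hev : ∀ᶠ ε in nhds (0 : ℝ), x + ε • (y - x) ∈ S := by
      have h2 : ∀ i, ∀ᶠ ε in nhds (0 : ℝ), l i (x + ε • (y - x)) ≤ b i := by
        intro i
        rcases (hx.1.2 i).eq_or_lt with h | h
        · refine Filter.Eventually.of_forall fun ε => ?_
          simp [h, hxy' i h]
        · have hc : Continuous fun ε : ℝ => l i (x + ε • (y - x)) := by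
            have := hlc i
            fun_prop
          have ht : Filter.Tendsto (fun ε : ℝ => l i (x + ε • (y - x))) (nhds 0)
              (nhds (l i x)) := by
            simpa using hc.tendsto 0
          exact (ht.eventually_lt_const h).mono fun _ h => h.le
      filter_upwards [Filter.eventually_all.2 h2] with ε hε
      refine ⟨fun j => ?_, hε⟩
      simp [hx.1.1 j, hy.1.1 j]
    obtain ⟨δ, hδ, hball⟩ := Metric.eventually_nhds_iff.1 hev
    have h1 : x + (δ / 2) • (y - x) ∈ S := hball (by
      rw [dist_zero_right, Real.norm_eq_abs, abs_of_pos (by positivity)]; linarith)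
    have h2 : x + (-(δ / 2)) • (y - x) ∈ S := hball (by
      rw [dist_zero_right, Real.norm_eq_abs, abs_neg, abs_of_pos (by positivity)]; linarith)
    have hseg : x ∈ openSegment ℝ (x + (δ / 2) • (y - x)) (x + (-(δ / 2)) • (y - x)) := by
      refine ⟨1 / 2, 1 / 2, by norm_num, by norm_num, by norm_num, ?_⟩
      module
    have := hx.2 h1 h2 hseg
    have h0 : (δ / 2) • (y - x) = 0 := by simpa using this
    rcases smul_eq_zero.1 h0 with h | h
    · linarith
    · exact (sub_eq_zero.1 h).symm
  refine ⟨S.extremePoints ℝ, hfin, ?_⟩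
  have hhull := closure_convexHull_extremePoints hcomp hconv
  rwa [(Set.Finite.isClosed_convexHull ℝ hfin).closure_eq, eq_comm] at hhull

/-! ### Projective equivalence implies combinatorial equivalence -/

/-- A projective bijection `x ↦ (g x)⁻¹ • A x` whose inverse is `y ↦ (g' y)⁻¹ • A' y` maps faces to
faces: if the linear functional `l` has maximum `a` on `S`, then multiplying `a - l` by the
denominator `g'` of the inverse gives the affine function `a * g' - l ∘ A'`, which is nonnegative on
`T` and vanishes exactly on the image of the face. -/
theorem IsExposed.image_projective {k m : ℕ} {S : Set (Fin k → ℝ)} {T : Set (Fin m → ℝ)}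
    (A : (Fin k → ℝ) →ᵃ[ℝ] (Fin m → ℝ)) (g : (Fin k → ℝ) →ᵃ[ℝ] ℝ)
    (A' : (Fin m → ℝ) →ᵃ[ℝ] (Fin k → ℝ)) (g' : (Fin m → ℝ) →ᵃ[ℝ] ℝ)
    (hg' : ∀ y ∈ T, 0 < g' y)
    (hST : ∀ x ∈ S, (g x)⁻¹ • A x ∈ T) (hTS : ∀ y ∈ T, (g' y)⁻¹ • A' y ∈ S)
    (hleft : ∀ x ∈ S, (g' ((g x)⁻¹ • A x))⁻¹ • A' ((g x)⁻¹ • A x) = x)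
    (hright : ∀ y ∈ T, (g ((g' y)⁻¹ • A' y))⁻¹ • A ((g' y)⁻¹ • A' y) = y)
    {F : Set (Fin k → ℝ)} (hF : IsExposed ℝ S F) :
    IsExposed ℝ T ((fun x => (g x)⁻¹ • A x) '' F) := by
  rintro hne
  obtain ⟨x₀, hx₀⟩ := Set.image_nonempty.1 hne
  obtain ⟨l, rfl⟩ := hF ⟨x₀, hx₀⟩
  set h : (Fin m → ℝ) →ᵃ[ℝ] ℝ := l x₀ • g' - l.toLinearMap.toAffineMap.comp A' with hh
  have hval : ∀ y ∈ T, h y = g' y * (l x₀ - l ((g' y)⁻¹ • A' y)) := by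
    intro y hy
    have := (hg' y hy).ne'
    simp only [map_smul, smul_eq_mul]
    change l x₀ * g' y - l (A' y) = _
    field_simp
  have hnonneg : ∀ y ∈ T, 0 ≤ h y := by
    intro y hy
    rw [hval y hy]
    exact mul_nonneg (hg' y hy).le (sub_nonneg.2 (hx₀.2 _ (hTS y hy)))
  have hsub : ∀ s t, h s - h t = h.linear (s - t) := by
    intro s t
    have := h.linearMap_vsub s t
    simpa using this.symm
  refine ⟨-(LinearMap.toContinuousLinearMap h.linear), ?_⟩
  have hle : ∀ s t, (-(LinearMap.toContinuousLinearMap h.linear)) s ≤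
      (-(LinearMap.toContinuousLinearMap h.linear)) t ↔ h t ≤ h s := by
    intro s t
    have := hsub s t
    rw [map_sub] at this
    simp only [neg_apply, LinearMap.coe_toContinuousLinearMap']
    constructor <;> intro <;> linarith
  ext t
  simp only [hle, Set.mem_image, Set.mem_ofPred_eq]
  constructor
  · rintro ⟨x, ⟨hxS, hx⟩, rfl⟩
    refine ⟨hST x hxS, fun s hs => ?_⟩
    rw [hval _ (hST x hxS), hleft x hxS, le_antisymm (hx₀.2 x hxS) (hx x₀ hx₀.1)]
    simpa using hnonneg s hs
  · rintro ⟨htT, ht⟩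
    refine ⟨(g' t)⁻¹ • A' t, ⟨hTS t htT, fun y hy => ?_⟩, hright t htT⟩
    have h0 : h t ≤ 0 := by
      have := ht _ (hST x₀ hx₀.1)
      rwa [hval _ (hST x₀ hx₀.1), hleft x₀ hx₀.1, sub_self, mul_zero] at this
    rw [hval t htT] at h0
    have := nonpos_of_mul_nonpos_right h0 (hg' t htT)
    have := hx₀.2 y hy
    linarith

/-- Two sets that correspond to each other under a projective transformation, defined on both of
them, have isomorphic face lattices. -/
theorem CombEquiv.of_projective {k m : ℕ} {S : Set (Fin k → ℝ)} {T : Set (Fin m → ℝ)}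
    (A : (Fin k → ℝ) →ᵃ[ℝ] (Fin m → ℝ)) (g : (Fin k → ℝ) →ᵃ[ℝ] ℝ)
    (A' : (Fin m → ℝ) →ᵃ[ℝ] (Fin k → ℝ)) (g' : (Fin m → ℝ) →ᵃ[ℝ] ℝ)
    (hg : ∀ x ∈ S, 0 < g x) (hg' : ∀ y ∈ T, 0 < g' y)
    (hST : ∀ x ∈ S, (g x)⁻¹ • A x ∈ T) (hTS : ∀ y ∈ T, (g' y)⁻¹ • A' y ∈ S)
    (hleft : ∀ x ∈ S, (g' ((g x)⁻¹ • A x))⁻¹ • A' ((g x)⁻¹ • A x) = x)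
    (hright : ∀ y ∈ T, (g ((g' y)⁻¹ • A' y))⁻¹ • A ((g' y)⁻¹ • A' y) = y) :
    CombEquiv S T := by
  have hl : ∀ F ⊆ S, (fun y => (g' y)⁻¹ • A' y) '' ((fun x => (g x)⁻¹ • A x) '' F) = F := by
    intro F hF
    rw [Set.image_image]
    exact (Set.image_congr fun x hx => hleft x (hF hx)).trans (Set.image_id' F)
  have hr : ∀ F ⊆ T, (fun x => (g x)⁻¹ • A x) '' ((fun y => (g' y)⁻¹ • A' y) '' F) = F := by
    intro F hF
    rw [Set.image_image]
    exact (Set.image_congr fun x hx => hright x (hF hx)).trans (Set.image_id' F)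
  let Φ : FaceLattice S ≃ FaceLattice T :=
    { toFun := fun F => ⟨_, F.2.image_projective A g A' g' hg' hST hTS hleft hright⟩
      invFun := fun F => ⟨_, F.2.image_projective A' g' A g hg hTS hST hright hleft⟩
      left_inv := fun F => Subtype.ext (hl _ F.2.subset)
      right_inv := fun F => Subtype.ext (hr _ F.2.subset) }
  exact ⟨Φ.toOrderIso (fun _ _ h => Set.image_mono h) (fun _ _ h => Set.image_mono h)⟩

/-! ### Linear equations of the logarithmic Voronoi cell -/

theorem EReal.coe_sum_eq {ι : Type*} (s : Finset ι) (f : ι → ℝ) :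
    ((∑ i ∈ s, f i : ℝ) : EReal) = ∑ i ∈ s, (f i : EReal) := by
  classical
  induction s using Finset.induction_on with
  | empty => simp
  | insert a s ha ih => rw [Finset.sum_insert ha, Finset.sum_insert ha, EReal.coe_add, ih]

theorem logLikelihood_of_pos {n : ℕ} (u : Fin n → ℝ) {x : Fin n → ℝ} (hx : ∀ i, 0 < x i) :
    logLikelihood u x = ((∑ i, u i * Real.log (x i) : ℝ) : EReal) := by
  rw [EReal.coe_sum_eq]
  refine Finset.sum_congr rfl fun i _ => ?_
  rw [ENNReal.log_ofReal_of_pos (hx i), EReal.coe_mul]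

/-- The tangent line of `log` at `p` lies above the graph; for `x = 0` the left side is `-∞` or
`0`. -/
theorem mul_log_ofReal_le {u p x : ℝ} (hu : 0 ≤ u) (hp : 0 < p) (hx : 0 ≤ x) :
    (u : EReal) * ENNReal.log (ENNReal.ofReal x) ≤
      ((u * Real.log p + u / p * (x - p) : ℝ) : EReal) := by
  rcases hx.eq_or_lt with rfl | hx
  · rcases hu.eq_or_lt with rfl | hu
    · simp
    · simp [EReal.coe_mul_bot_of_pos hu]
  · rw [ENNReal.log_ofReal_of_pos hx, ← EReal.coe_mul, EReal.coe_le_coe_iff]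
    have h := Real.log_le_sub_one_of_pos (div_pos hx hp)
    rw [Real.log_div hx.ne' hp.ne'] at h
    calc u * Real.log x ≤ u * (Real.log p + (x / p - 1)) := by gcongr; linarith
      _ = u * Real.log p + u / p * (x - p) := by field_simp

/-- The logarithmic Voronoi cell at an interior point is cut out of the simplex by the critical
equations of the log-likelihood function at `p`; these suffice since that function is concave. -/
theorem mem_logVoronoiCell_iff {n d : ℕ} {c : Fin n → ℝ} {B : Matrix (Fin n) (Fin d) ℝ}
    {p : Fin n → ℝ} (hp : p ∈ linearModel c B) (hpos : ∀ i, 0 < p i) {u : Fin n → ℝ} :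
    u ∈ logVoronoiCell (linearModel c B) p ↔
      ((∀ i, 0 ≤ u i) ∧ ∑ i, u i = 1) ∧ ∀ j, ∑ i, u i / p i * B i j = 0 := by
  obtain ⟨x, hx, -⟩ := id hp
  constructor
  · rintro ⟨hu, -, hmax⟩
    refine ⟨hu, fun j => ?_⟩
    have hderiv : HasDerivAt (fun t : ℝ => ∑ i, u i * Real.log (p i - t * B i j))
        (∑ i, u i * (-B i j / p i)) 0 := by
      refine HasDerivAt.fun_sum fun i _ => ?_
      have h1 : HasDerivAt (fun t : ℝ => p i - t * B i j) (-B i j) 0 := by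
        simpa using ((hasDerivAt_id (0 : ℝ)).mul_const (B i j)).const_sub (p i)
      have h2 := (h1.log (by simpa using (hpos i).ne')).const_mul (u i)
      simpa using h2
    have hloc : IsLocalMax (fun t : ℝ => ∑ i, u i * Real.log (p i - t * B i j)) 0 := by
      have hev : ∀ᶠ t in nhds (0 : ℝ), ∀ i, 0 < p i - t * B i j := by
        refine Filter.eventually_all.2 fun i => ?_
        have hc : Continuous fun t : ℝ => p i - t * B i j := by fun_prop
        have ht : Filter.Tendsto (fun t : ℝ => p i - t * B i j) (nhds 0) (nhds (p i)) := by
          simpa using hc.tendsto 0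
        exact ht.eventually_const_lt (hpos i)
      filter_upwards [hev] with t ht
      have hq : (fun i => p i - t * B i j) ∈ linearModel c B := by
        refine ⟨x + t • Pi.single j 1, ?_, fun i => (ht i).le⟩
        ext i
        simp [hx, Matrix.mulVec_add, Matrix.mulVec_smul]
        ring
      have := hmax hq
      simp only [Set.mem_ofPred_eq] at this
      rw [logLikelihood_of_pos u ht, logLikelihood_of_pos u hpos, EReal.coe_le_coe_iff] at this
      simpa using this
    have h0 := hloc.hasDerivAt_eq_zero hderiv
    rw [← neg_eq_zero, ← h0, ← Finset.sum_neg_distrib]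
    exact Finset.sum_congr rfl fun i _ => by ring
  · rintro ⟨hu, hcrit⟩
    refine ⟨hu, hp, ?_⟩
    rintro q ⟨y, hy, hq⟩
    have hlin : ∑ i, u i / p i * (q i - p i) = 0 := by
      have hqp : ∀ i, q i - p i = ∑ j, B i j * (x j - y j) := by
        intro i
        simp only [hx, hy, Pi.sub_apply, Matrix.mulVec, dotProduct, mul_sub,
          Finset.sum_sub_distrib]
        ring
      simp only [hqp, Finset.mul_sum]
      rw [Finset.sum_comm]
      refine Finset.sum_eq_zero fun j _ => ?_
      simp only [← mul_assoc]
      rw [← Finset.sum_mul, hcrit j, zero_mul]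
    simp only [Set.mem_ofPred_eq]
    calc logLikelihood u q
        ≤ ∑ i, ((u i * Real.log (p i) + u i / p i * (q i - p i) : ℝ) : EReal) :=
          Finset.sum_le_sum fun i _ => mul_log_ofReal_le (hu.1 i) (hpos i) (hq i)
      _ = logLikelihood u p := by
          rw [← EReal.coe_sum_eq, Finset.sum_add_distrib, hlin, add_zero,
            logLikelihood_of_pos u hpos]

theorem isPolytope_logVoronoiCell {n d : ℕ} {c : Fin n → ℝ} {B : Matrix (Fin n) (Fin d) ℝ}
    {p : Fin n → ℝ} (hp : p ∈ linearModel c B) (hpos : ∀ i, 0 < p i) :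
    IsPolytope (logVoronoiCell (linearModel c B) p) := by
  -- the equations are indexed by `Option (Fin d)`, with `none` for the sum of the coordinates
  let A : Option (Fin d) → (Fin n → ℝ) →ₗ[ℝ] ℝ := fun o =>
    ∑ i, (o.elim 1 fun j => (p i)⁻¹ * B i j) • LinearMap.proj i
  let e : Option (Fin d) → ℝ := fun o => o.elim 1 fun _ => 0
  have heq : logVoronoiCell (linearModel c B) p = {u | (∀ o, A o u = e o) ∧
      ∀ i : Fin n, (-LinearMap.proj i : (Fin n → ℝ) →ₗ[ℝ] ℝ) u ≤ (0 : Fin n → ℝ) i} := by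
    ext u
    rw [mem_logVoronoiCell_iff hp hpos]
    simp only [Option.forall, A, e, Set.mem_ofPred_eq, LinearMap.sum_apply, LinearMap.smul_apply,
      LinearMap.proj_apply, Option.elim, one_mul, smul_eq_mul, LinearMap.neg_apply,
      Pi.zero_apply, Left.neg_nonpos_iff]
    have : ∀ j, ∑ i, u i / p i * B i j = ∑ i, (p i)⁻¹ * B i j * u i := fun j =>
      Finset.sum_congr rfl fun i _ => by ring
    simp only [this]
    tauto
  have hbd : Bornology.IsBounded (logVoronoiCell (linearModel c B) p) :=
    (bounded_stdSimplex (Fin n)).subset fun u hu => hu.1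
  rw [heq] at hbd ⊢
  exact isPolytope_of_isBounded _ _ _ _ hbd

/-! ### Polar duals of polytopes -/

theorem nonneg_on_convexHull {n m : ℕ} {v : Fin n → Fin m → ℝ} {a : ℝ} {z : Fin m → ℝ}
    (h : ∀ i, 0 ≤ a + z ⬝ᵥ v i) {x : Fin m → ℝ} (hx : x ∈ convexHull ℝ (Set.range v)) :
    0 ≤ a + z ⬝ᵥ x := by
  have hconv : Convex ℝ {x : Fin m → ℝ | 0 ≤ a + z ⬝ᵥ x} := by
    intro x hx y hy s t hs ht hst
    simp only [Set.mem_ofPred_eq, dotProduct_add, dotProduct_smul, smul_eq_mul] at *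
    have h1 := mul_nonneg hs hx
    have h2 := mul_nonneg ht hy
    have h3 : a = s * a + t * a := by rw [← add_mul, hst, one_mul]
    linarith
  have hsub : Set.range v ⊆ {x : Fin m → ℝ | 0 ≤ a + z ⬝ᵥ x} := Set.range_subset_iff.2 h
  exact convexHull_min hsub hconv hx

/-- An affine function that is nonnegative on a polytope is positive on its interior, unless it is
identically zero. -/
theorem pos_or_zero_of_mem_interior {n m : ℕ} {v : Fin n → Fin m → ℝ} {a : ℝ} {z o : Fin m → ℝ}
    (ho : o ∈ interior (convexHull ℝ (Set.range v))) (h : ∀ i, 0 ≤ a + z ⬝ᵥ v i) :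
    0 < a + z ⬝ᵥ o ∨ (a = 0 ∧ z = 0) := by
  rcases (nonneg_on_convexHull h (interior_subset ho)).lt_or_eq with h0 | h0
  · exact Or.inl h0
  right
  -- a small step from the zero `o` against the gradient `z` must not make the function negative
  have hc : Continuous fun t : ℝ => o - t • z := by fun_prop
  have ht : Filter.Tendsto (fun t : ℝ => o - t • z) (nhds 0) (nhds o) := by
    simpa using hc.tendsto 0
  obtain ⟨δ, hδ, hball⟩ := Metric.eventually_nhds_iff.1
    (ht.eventually (mem_interior_iff_mem_nhds.1 ho))
  have hmem := hball (y := δ / 2) (by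
    rw [dist_zero_right, Real.norm_eq_abs, abs_of_pos (by positivity)]; linarith)
  have h1 := nonneg_on_convexHull h hmem
  simp only [dotProduct_sub, dotProduct_smul, smul_eq_mul] at h1
  have h2 : 0 ≤ z ⬝ᵥ z := Finset.sum_nonneg fun i _ => mul_self_nonneg _
  have h3 : z ⬝ᵥ z = 0 := by
    have : δ / 2 * (z ⬝ᵥ z) ≤ 0 := by linarith
    exact le_antisymm (nonpos_of_mul_nonpos_right this (by positivity)) h2
  have hz := dotProduct_self_eq_zero.1 h3
  refine ⟨?_, hz⟩
  simpa [hz] using h0.symm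

theorem mem_polarDual_convexHull_range {n m : ℕ} {v : Fin n → Fin m → ℝ} {z : Fin m → ℝ} :
    z ∈ polarDual (convexHull ℝ (Set.range v)) ↔ ∀ i, z ⬝ᵥ v i ≤ 1 := by
  constructor
  · exact fun h i => h _ (subset_convexHull ℝ _ (Set.mem_range_self i))
  · intro h y hy
    have := nonneg_on_convexHull (a := 1) (z := -z) (v := v)
      (fun i => by rw [neg_dotProduct]; linarith [h i]) hy
    rw [neg_dotProduct] at this
    linarith

theorem isPolytope_polarDual {n m : ℕ} {v : Fin n → Fin m → ℝ} {o : Fin m → ℝ}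
    (ho : o ∈ interior (convexHull ℝ (Set.range v))) :
    IsPolytope (polarDual (convexHull ℝ (Set.range fun i => v i - o))) := by
  let l : Fin n → (Fin m → ℝ) →ₗ[ℝ] ℝ := fun i => ∑ k, (v i k - o k) • LinearMap.proj k
  have heq : polarDual (convexHull ℝ (Set.range fun i => v i - o)) =
      {z | (∀ j : Empty, (0 : (Fin m → ℝ) →ₗ[ℝ] ℝ) z = 0) ∧ ∀ i, l i z ≤ (1 : Fin n → ℝ) i} := by
    ext z
    rw [mem_polarDual_convexHull_range]
    simp [l, dotProduct, mul_comm]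
  have hbd : Bornology.IsBounded (polarDual (convexHull ℝ (Set.range fun i => v i - o))) := by
    obtain ⟨δ, hδ, hball⟩ := Metric.mem_nhds_iff.1 (mem_interior_iff_mem_nhds.1 ho)
    rw [isBounded_iff_forall_norm_le]
    refine ⟨2 / δ, fun z hz => ?_⟩
    rw [mem_polarDual_convexHull_range] at hz
    refine (pi_norm_le_iff_of_nonneg (by positivity)).2 fun k => ?_
    have key : ∀ s : ℝ, |s| < δ → z k * s ≤ 1 := by
      intro s hs
      have hmem : o + Pi.single k s ∈ convexHull ℝ (Set.range v) := hball (by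
        simpa [Metric.mem_ball, dist_eq_norm, Pi.norm_single] using hs)
      have := nonneg_on_convexHull (a := 1 + z ⬝ᵥ o) (z := -z) (v := v) (fun i => by
        have := hz i
        rw [dotProduct_sub] at this
        rw [neg_dotProduct]; linarith) hmem
      rw [neg_dotProduct, dotProduct_add, dotProduct_single] at this
      linarith
    have h1 := key (δ / 2) (by rw [abs_of_pos (by positivity)]; linarith)
    have h2 := key (-(δ / 2)) (by rw [abs_neg, abs_of_pos (by positivity)]; linarith)
    rw [Real.norm_eq_abs, abs_le, ← neg_div, div_le_iff₀ hδ, le_div_iff₀ hδ]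
    constructor <;> linarith
  rw [heq] at hbd ⊢
  exact isPolytope_of_isBounded _ _ _ _ hbd

/-! ### Gale transforms -/

/-- The linear map that sends `(a, z)` to the values at the points `v i` of the affine function
`x ↦ a + ⟨z, x⟩`. -/
def affineValues {n m : ℕ} (v : Fin n → Fin m → ℝ) : ℝ × (Fin m → ℝ) →ₗ[ℝ] (Fin n → ℝ) where
  toFun a i := a.1 + a.2 ⬝ᵥ v i
  map_add' a b := by ext i; simp [add_dotProduct]; ring
  map_smul' r a := by ext i; simp [smul_dotProduct]; ring

theorem affineValues_apply {n m : ℕ} (v : Fin n → Fin m → ℝ) (a : ℝ) (z : Fin m → ℝ) (i : Fin n) :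
    affineValues v (a, z) i = a + z ⬝ᵥ v i := rfl

/-- The transpose of `affineValues v`: it sends the weights `w` to
`(∑ i, w i, ∑ i, w i • v i)`, so that its kernel is the space of affine dependences of `v`. -/
def weightedSums {n m : ℕ} (v : Fin n → Fin m → ℝ) : (Fin n → ℝ) →ₗ[ℝ] ℝ × (Fin m → ℝ) where
  toFun w := (∑ i, w i, ∑ i, w i • v i)
  map_add' w w' := by simp [Finset.sum_add_distrib, add_smul]
  map_smul' r w := by simp [Finset.mul_sum, Finset.smul_sum, mul_smul]

theorem sum_mul_affineValues {n m : ℕ} (v : Fin n → Fin m → ℝ) (w : Fin n → ℝ)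
    (b : ℝ × (Fin m → ℝ)) :
    ∑ i, w i * affineValues v b i =
      b.1 * (weightedSums v w).1 + b.2 ⬝ᵥ (weightedSums v w).2 := by
  simp only [affineValues, weightedSums, LinearMap.coe_mk, AddHom.coe_mk, mul_add,
    Finset.sum_add_distrib, dotProduct_sum, dotProduct_smul, smul_eq_mul, Finset.mul_sum]
  congr 1
  exact Finset.sum_congr rfl fun i _ => mul_comm _ _

/-- The columns span a subspace of the hyperplane of vectors with sum `0`. -/
theorem rank_lt_of_sum_col_eq_zero {n d : ℕ} (hn : n ≠ 0) {B : Matrix (Fin n) (Fin d) ℝ}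
    (hB : ∀ j, ∑ i, B i j = 0) : B.rank < n := by
  rw [Matrix.rank_eq_finrank_span_cols]
  have hlt : Submodule.span ℝ (Set.range B.col) < ⊤ := by
    rw [lt_top_iff_ne_top]
    intro htop
    have hle : Submodule.span ℝ (Set.range B.col) ≤
        LinearMap.ker (∑ i, LinearMap.proj i : (Fin n → ℝ) →ₗ[ℝ] ℝ) := by
      rw [Submodule.span_le]
      rintro _ ⟨j, rfl⟩
      simpa using hB j
    have h1 : (1 : Fin n → ℝ) ∈ Submodule.span ℝ (Set.range B.col) := htop ▸ Submodule.mem_top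
    have h2 := hle h1
    simp [hn] at h2
  simpa using Submodule.finrank_lt hlt.ne

section Gale

variable {n d m : ℕ} {B : Matrix (Fin n) (Fin d) ℝ} {v : Fin n → Fin m → ℝ}

theorem IsGaleTransform.ker_weightedSums (h : IsGaleTransform B v) :
    LinearMap.ker (weightedSums v) = Submodule.span ℝ (Set.range B.col) := by
  ext w
  rw [h.2 w, LinearMap.mem_ker]
  simp [weightedSums, Prod.ext_iff]

theorem IsGaleTransform.range_weightedSums (h : IsGaleTransform B v) (hn : m + 1 + d = n) :
    LinearMap.range (weightedSums v) = ⊤ := by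
  apply Submodule.eq_top_of_finrank_eq
  have h1 := LinearMap.finrank_range_add_finrank_ker (weightedSums v)
  rw [h.ker_weightedSums, finrank_span_eq_card h.1] at h1
  simp only [Module.finrank_fintype_fun_eq_card, Fintype.card_fin] at h1
  simp only [Module.finrank_prod, Module.finrank_self, Module.finrank_fintype_fun_eq_card,
    Fintype.card_fin]
  omega

theorem IsGaleTransform.ker_affineValues (h : IsGaleTransform B v) (hn : m + 1 + d = n) :
    LinearMap.ker (affineValues v) = ⊥ := by
  rw [LinearMap.ker_eq_bot']
  intro b hb
  obtain ⟨w, hw⟩ := LinearMap.range_eq_top.1 (h.range_weightedSums hn) b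
  have h1 := sum_mul_affineValues v w b
  rw [hb, hw] at h1
  have h2 : 0 ≤ b.2 ⬝ᵥ b.2 := Finset.sum_nonneg fun i _ => mul_self_nonneg _
  have h3 := mul_self_nonneg b.1
  simp only [Pi.zero_apply, mul_zero, Finset.sum_const_zero] at h1
  exact Prod.ext (mul_self_eq_zero.1 (by linarith)) (dotProduct_self_eq_zero.1 (by linarith))

theorem IsGaleTransform.sum_affineValues_mul (h : IsGaleTransform B v) (b : ℝ × (Fin m → ℝ))
    (j : Fin d) : ∑ i, affineValues v b i * B i j = 0 := by
  have hker : B.col j ∈ LinearMap.ker (weightedSums v) := by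
    rw [h.ker_weightedSums]
    exact Submodule.subset_span (Set.mem_range_self j)
  have h1 := sum_mul_affineValues v (B.col j) b
  rw [LinearMap.mem_ker.1 hker] at h1
  simpa [mul_comm] using h1

/-- The vectors orthogonal to the columns of a Gale transform are the value vectors of affine
functions on the configuration. -/
theorem IsGaleTransform.exists_affineValues_eq (h : IsGaleTransform B v) (hn : m + 1 + d = n)
    {y : Fin n → ℝ} (hy : ∀ j, ∑ i, y i * B i j = 0) : ∃ b, affineValues v b = y := by
  have hle : LinearMap.range (affineValues v) ≤ LinearMap.ker B.transpose.mulVecLin := by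
    rintro _ ⟨b, rfl⟩
    ext j
    simpa [Matrix.vecMul, dotProduct] using h.sum_affineValues_mul b j
  have heq : LinearMap.range (affineValues v) = LinearMap.ker B.transpose.mulVecLin := by
    apply Submodule.eq_of_le_of_finrank_eq hle
    have h1 := LinearMap.finrank_range_add_finrank_ker B.transpose.mulVecLin
    have h2 := LinearMap.finrank_range_of_inj (LinearMap.ker_eq_bot.1 (h.ker_affineValues hn))
    change B.transpose.rank + _ = _ at h1
    rw [Matrix.rank_transpose, Matrix.rank_eq_finrank_span_cols, finrank_span_eq_card h.1] at h1
    simp only [Module.finrank_prod, Module.finrank_self, Module.finrank_fintype_fun_eq_card,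
      Fintype.card_fin] at h1 h2
    omega
  have hmem : y ∈ LinearMap.range (affineValues v) := by
    rw [heq, LinearMap.mem_ker]
    ext j
    simpa [Matrix.vecMul, dotProduct] using hy j
  exact hmem

theorem IsGaleTransform.interior_nonempty (h : IsGaleTransform B v) (hn : m + 1 + d = n) :
    (interior (convexHull ℝ (Set.range v))).Nonempty := by
  rw [interior_convexHull_nonempty_iff_affineSpan_eq_top, eq_top_iff]
  intro x _
  obtain ⟨w, hw⟩ := LinearMap.range_eq_top.1 (h.range_weightedSums hn) (1, x)
  simp only [weightedSums, LinearMap.coe_mk, AddHom.coe_mk, Prod.mk.injEq] at hw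
  rw [← hw.2, ← Finset.affineCombination_eq_linear_combination _ _ _ hw.1]
  exact affineCombination_mem_affineSpan hw.1 v

/-- The points `v i` are the images of the standard basis vectors under a linear map whose
restriction to the hyperplane of vectors with sum `0` has the span of the columns as its kernel. -/
theorem exists_isGaleTransform (hn : m + 1 + d = n) (hB : ∀ j, ∑ i, B i j = 0)
    (hrank : B.rank = d) : ∃ v : Fin n → Fin m → ℝ, IsGaleTransform B v := by
  have hli : LinearIndependent ℝ B.col := by
    rw [linearIndependent_iff_card_eq_finrank_span, Set.finrank,
      ← Matrix.rank_eq_finrank_span_cols, hrank, Fintype.card_fin]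
  let σ : (Fin n → ℝ) →ₗ[ℝ] ℝ := ∑ i, LinearMap.proj i
  have hσ : ∀ w, σ w = ∑ i, w i := fun w => by simp [σ]
  let W := Submodule.span ℝ (Set.range B.col)
  have hW : W ≤ LinearMap.ker σ := by
    rw [Submodule.span_le]
    rintro _ ⟨j, rfl⟩
    simpa [hσ] using hB j
  let W' : Submodule ℝ (LinearMap.ker σ) := W.comap (LinearMap.ker σ).subtype
  have hσtop : LinearMap.range σ = ⊤ := by
    rw [LinearMap.range_eq_top]
    intro r
    exact ⟨Pi.single ⟨0, by omega⟩ r, by simp [hσ]⟩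
  have hfW : Module.finrank ℝ W' = d := by
    rw [(Submodule.comapSubtypeEquivOfLe hW).finrank_eq, finrank_span_eq_card hli,
      Fintype.card_fin]
  have hfK : 1 + Module.finrank ℝ (LinearMap.ker σ) = n := by
    have := LinearMap.finrank_range_add_finrank_ker σ
    rw [hσtop] at this
    simpa using this
  have hfQ : Module.finrank ℝ (LinearMap.ker σ ⧸ W') = Module.finrank ℝ (Fin m → ℝ) := by
    have := Submodule.finrank_quotient_add_finrank W'
    rw [Module.finrank_fintype_fun_eq_card, Fintype.card_fin]
    omega
  let E := LinearEquiv.ofFinrankEq _ _ hfQ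
  obtain ⟨T, hT⟩ := LinearMap.exists_extend (E.toLinearMap ∘ₗ W'.mkQ)
  refine ⟨fun i => T (Pi.single i 1), hli, fun w => ?_⟩
  have hTw : ∑ i, w i • T (Pi.single i 1) = T w := by
    simp only [← map_smul, ← map_sum]
    congr 1
    ext k
    simp [Finset.sum_apply, Pi.single_apply]
  rw [hTw, ← hσ]
  have hmem : ∀ hw : σ w = 0, T w = 0 ↔ w ∈ W := by
    intro hw
    have h1 : T w = E (W'.mkQ ⟨w, hw⟩) := LinearMap.congr_fun hT ⟨w, hw⟩
    rw [h1, LinearEquiv.map_eq_zero_iff, Submodule.mkQ_apply, Submodule.Quotient.mk_eq_zero]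
    rfl
  constructor
  · exact fun hw => ⟨hW hw, (hmem (hW hw)).2 hw⟩
  · exact fun hw => (hmem hw.1).1 hw.2

end Gale

/-! ### The combinatorial type of the cell -/

/-- With `y i = u i / p i`, a point `u` of the cell becomes the vector of values at the points
`v i` of an affine function `f`, nonnegative on them and positive at `o`. The projective map
normalizes `f` to `f o = 1`, so that `f x = 1 - ⟨z, x - o⟩` with `z` in the polar dual; the inverse
map normalizes `∑ i, p i * f (v i)` to `1` instead. -/
theorem combEquiv_logVoronoiCell_polarDual {n d m : ℕ} {c : Fin n → ℝ}
    {B : Matrix (Fin n) (Fin d) ℝ} {p : Fin n → ℝ} (hp : p ∈ linearModel c B)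
    (hpos : ∀ i, 0 < p i) {v : Fin n → Fin m → ℝ} (hv : IsGaleTransform B v)
    (hn : m + 1 + d = n) {o : Fin m → ℝ} (ho : o ∈ interior (convexHull ℝ (Set.range v))) :
    CombEquiv (logVoronoiCell (linearModel c B) p)
      (polarDual (convexHull ℝ (Set.range fun i => v i - o))) := by
  obtain ⟨R, hR⟩ := (affineValues v).exists_leftInverse_of_injective (hv.ker_affineValues hn)
  have hR' : ∀ b, R (affineValues v b) = b := fun b => LinearMap.congr_fun hR b
  let D : (Fin n → ℝ) →ₗ[ℝ] (Fin n → ℝ) := LinearMap.pi fun i => (p i)⁻¹ • LinearMap.proj i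
  have hD : ∀ u i, D u i = (p i)⁻¹ * u i := fun u i => rfl
  let ev : ℝ × (Fin m → ℝ) →ₗ[ℝ] ℝ :=
    { toFun := fun b => b.1 + b.2 ⬝ᵥ o
      map_add' := fun a b => by simp [add_dotProduct]; ring
      map_smul' := fun r a => by simp [smul_dotProduct]; ring }
  let A : (Fin n → ℝ) →ₗ[ℝ] (Fin m → ℝ) := -(LinearMap.snd ℝ ℝ (Fin m → ℝ) ∘ₗ R ∘ₗ D)
  let g : (Fin n → ℝ) →ₗ[ℝ] ℝ := ev ∘ₗ R ∘ₗ D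
  have hA : ∀ u, A u = -(R (D u)).2 := fun u => rfl
  have hg : ∀ u, g u = (R (D u)).1 + (R (D u)).2 ⬝ᵥ o := fun u => rfl
  let L : (Fin m → ℝ) →ₗ[ℝ] (Fin n → ℝ) :=
    { toFun := fun t i => p i * (t ⬝ᵥ (v i - o))
      map_add' := fun s t => by ext i; simp only [add_dotProduct, Pi.add_apply]; ring
      map_smul' := fun r t => by
        ext i; simp only [smul_dotProduct, Pi.smul_apply, smul_eq_mul, RingHom.id_apply]; ring }
  let σ : (Fin n → ℝ) →ₗ[ℝ] ℝ := ∑ i, LinearMap.proj i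
  have hσ : ∀ w, σ w = ∑ i, w i := fun w => by simp [σ]
  let A' : (Fin m → ℝ) →ᵃ[ℝ] (Fin n → ℝ) := AffineMap.const ℝ _ p - L.toAffineMap
  let g' : (Fin m → ℝ) →ᵃ[ℝ] ℝ := σ.toAffineMap.comp A'
  have hA' : ∀ t i, A' t i = p i * affineValues v (1 + t ⬝ᵥ o, -t) i := by
    intro t i
    change p i - p i * (t ⬝ᵥ (v i - o)) = _
    rw [affineValues_apply, dotProduct_sub, neg_dotProduct]
    ring
  have hg' : ∀ t, g' t = ∑ i, A' t i := fun t => hσ _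
  have hDA' : ∀ t, D (A' t) = affineValues v (1 + t ⬝ᵥ o, -t) := by
    intro t
    ext i
    rw [hD, hA', inv_mul_cancel_left₀ (hpos i).ne']
  have hcell : ∀ u ∈ logVoronoiCell (linearModel c B) p,
      affineValues v (R (D u)) = D u ∧ (∀ i, 0 ≤ u i) ∧ ∑ i, u i = 1 := by
    intro u hu
    rw [mem_logVoronoiCell_iff hp hpos] at hu
    refine ⟨?_, hu.1⟩
    obtain ⟨b, hb⟩ := hv.exists_affineValues_eq hn (y := D u) fun j => by
      rw [← hu.2 j]
      exact Finset.sum_congr rfl fun i _ => by rw [hD]; ring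
    rw [← hb, hR']
  have hgpos : ∀ u ∈ logVoronoiCell (linearModel c B) p, 0 < g u := by
    intro u hu
    obtain ⟨h1, h2, h3⟩ := hcell u hu
    rcases pos_or_zero_of_mem_interior (a := (R (D u)).1) (z := (R (D u)).2) ho (fun i => by
      have := congrFun h1 i
      rw [← affineValues_apply, Prod.mk.eta, this, hD]
      exact mul_nonneg (inv_nonneg.2 (hpos i).le) (h2 i)) with h | h
    · exact h
    · exfalso
      have h0 : R (D u) = 0 := Prod.ext h.1 h.2
      rw [h0, map_zero] at h1
      have hu0 : ∀ i, u i = 0 := by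
        intro i
        have := (congrFun h1 i).symm
        rw [hD] at this
        simpa [(hpos i).ne'] using this
      simp [hu0] at h3
  have hdual : ∀ t ∈ polarDual (convexHull ℝ (Set.range fun i => v i - o)), ∀ i, 0 ≤ A' t i := by
    intro t ht i
    have := mem_polarDual_convexHull_range.1 ht i
    rw [dotProduct_sub] at this
    rw [hA', affineValues_apply, neg_dotProduct]
    exact mul_nonneg (hpos i).le (by linarith)
  have hg'pos : ∀ t ∈ polarDual (convexHull ℝ (Set.range fun i => v i - o)), 0 < g' t := by
    intro t ht
    have h0 := hdual t ht
    rw [hg']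
    refine (Finset.sum_nonneg fun i _ => h0 i).lt_of_ne' fun hz => ?_
    have hz' := (Finset.sum_eq_zero_iff_of_nonneg fun i _ => h0 i).1 hz
    have hAz : A' t = 0 := funext fun i => hz' i (Finset.mem_univ i)
    have := hDA' t
    rw [hAz, map_zero] at this
    have hb := hR' (1 + t ⬝ᵥ o, -t)
    rw [← this, map_zero] at hb
    have h1 := congrArg Prod.fst hb
    have h2 := neg_eq_zero.1 (congrArg Prod.snd hb).symm
    simp [h2] at h1
  have hright : ∀ t ∈ polarDual (convexHull ℝ (Set.range fun i => v i - o)),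
      (g ((g' t)⁻¹ • A' t))⁻¹ • A ((g' t)⁻¹ • A' t) = t := by
    intro t ht
    have hs := (hg'pos t ht).ne'
    have h1 : g (A' t) = 1 := by rw [hg, hDA', hR', neg_dotProduct]; ring
    have h2 : A (A' t) = t := by rw [hA, hDA', hR', neg_neg]
    rw [map_smul, map_smul, h1, h2, smul_smul, smul_eq_mul, mul_one, inv_inv,
      mul_inv_cancel₀ hs, one_smul]
  have hleft : ∀ u ∈ logVoronoiCell (linearModel c B) p,
      A' ((g u)⁻¹ • A u) = (g u)⁻¹ • u := by
    intro u hu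
    have hs := (hgpos u hu).ne'
    ext i
    have h1 := congrFun (hcell u hu).1 i
    rw [← Prod.mk.eta (p := R (D u)), affineValues_apply, hD] at h1
    have h2 : u i = p i * ((R (D u)).1 + (R (D u)).2 ⬝ᵥ v i) := by
      rw [h1, mul_inv_cancel_left₀ (hpos i).ne']
    rw [hA', affineValues_apply, hA, Pi.smul_apply, smul_eq_mul, h2]
    simp only [smul_dotProduct, neg_dotProduct, smul_eq_mul]
    have h3 := hg u
    field_simp
    linear_combination p i * h3
  refine CombEquiv.of_projective A.toAffineMap g.toAffineMap A' g' hgpos hg'pos ?_ ?_ ?_ hright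
  · intro u hu
    change (g u)⁻¹ • A u ∈ _
    rw [mem_polarDual_convexHull_range]
    intro i
    have h1 := congrFun (hleft u hu) i
    rw [hA', affineValues_apply, neg_dotProduct] at h1
    have h2 : 0 ≤ ((g u)⁻¹ • u) i :=
      mul_nonneg (inv_nonneg.2 (hgpos u hu).le) ((hcell u hu).2.1 i)
    rw [← h1] at h2
    have h3 := nonneg_of_mul_nonneg_right h2 (hpos i)
    rw [dotProduct_sub]
    linarith
  · intro t ht
    have hs := hg'pos t ht
    rw [mem_logVoronoiCell_iff hp hpos]
    refine ⟨⟨fun i => mul_nonneg (inv_nonneg.2 hs.le) (hdual t ht i), ?_⟩, fun j => ?_⟩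
    · simp only [Pi.smul_apply, smul_eq_mul]
      rw [← Finset.mul_sum, ← hg', inv_mul_cancel₀ hs.ne']
    · have h1 := hv.sum_affineValues_mul (1 + t ⬝ᵥ o, -t) j
      rw [← mul_zero (g' t)⁻¹, ← h1, Finset.mul_sum]
      refine Finset.sum_congr rfl fun i _ => ?_
      rw [Pi.smul_apply, smul_eq_mul, hA']
      have := (hpos i).ne'
      field_simp
  · intro u hu
    change (g' ((g u)⁻¹ • A u))⁻¹ • A' ((g u)⁻¹ • A u) = u
    have hs := (hgpos u hu).ne'
    have h1 : g' ((g u)⁻¹ • A u) = (g u)⁻¹ := by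
      rw [hg', hleft u hu]
      simp only [Pi.smul_apply, smul_eq_mul]
      rw [← Finset.mul_sum, (hcell u hu).2.2, mul_one]
    rw [h1, hleft u hu, inv_inv, smul_smul, mul_inv_cancel₀ hs, one_smul]

theorem mainTheorem1 {n d : ℕ} (c : Fin n → ℝ) (B : Matrix (Fin n) (Fin d) ℝ)
    (hc : ∑ i, c i = 1) (hB : ∀ j, ∑ i, B i j = 0) (hrank : B.rank = d)
    (p : Fin n → ℝ) (hp : p ∈ linearModel c B) (hpos : ∀ i, 0 < p i) :
    IsPolytope (logVoronoiCell (linearModel c B) p) ∧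
    (∃ v : Fin n → Fin (n - d - 1) → ℝ, IsGaleTransform B v) ∧
    ∀ v : Fin n → Fin (n - d - 1) → ℝ, IsGaleTransform B v →
      (interior (convexHull ℝ (Set.range v))).Nonempty ∧
      ∀ o ∈ interior (convexHull ℝ (Set.range v)),
        IsPolytope (polarDual (convexHull ℝ (Set.range fun i => v i - o))) ∧
        CombEquiv (logVoronoiCell (linearModel c B) p)
          (polarDual (convexHull ℝ (Set.range fun i => v i - o))) := by
  have hn0 : n ≠ 0 := by
    rintro rfl
    simp at hc
  have hlt := rank_lt_of_sum_col_eq_zero hn0 hB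
  -- the subtractions in `n - d - 1` do not truncate
  have hn : n - d - 1 + 1 + d = n := by omega
  exact ⟨isPolytope_logVoronoiCell hp hpos, exists_isGaleTransform hn hB hrank, fun v hv =>
    ⟨hv.interior_nonempty hn, fun o ho => ⟨isPolytope_polarDual ho,
      combEquiv_logVoronoiCell_polarDual hp hpos hv hn ho⟩⟩⟩
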